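/- Let $D$ be a commutative unital Noetherian domain. Let $D\langle X\rangle$ be the free unital associative $D$-algebra on $X=Y\cup Z$, where $Y=\{y_1,y_2,\dots\}$ and $Z=\{z_1,z_2,\dots\}$ are disjoint countably infinite sets, $\mathbb{Z}_2$-graded so that each $y_i$ has degree $0$ and each $z_i$ has degree $1$, and let $L\langle X\rangle$ be the Lie subalgebra of $D\langle X\rangle$ (under the commutator $[a,b]=ab-ba$) generated by $X$. A two-sided ideal of $D\langle X\rangle$ is called a weak T-ideal if it is closed under every unital $D$-algebra endomorphism of $D\langle X\rangle$ that preserves the degrees and maps $L\langle X\rangle$ into itself. The weak T-ideal generated by a set $S$ is the intersection of all weak T-ideals containing $S$, and a weak T-ideal is finitely generated if it is generated, as a weak T-ideal, by some finite set. Let $I$ be the weak T-ideal generated by $[y_1,y_2]$, $z_1z_2z_3-z_3z_2z_1$ and $y_1z_1+z_1y_1$. Then every weak T-ideal containing $I$ is finitely generated as a weak T-ideal; if moreover it is homogeneous in the $\mathbb{Z}_2$-grading, then it is generated as a weak T-ideal by finitely many homogeneous elements. In particular, grade $M_2(D)$ by taking the diagonal matrices as degree $0$ and the off-diagonal matrices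 as degree $1$, and let $T$ be the set of all $f\in D\langle X\rangle$ that vanish in $M_2(D)$ under every substitution of the $y_i$ by diagonal matrices in $sl_2(D)$ and of the $z_i$ by off-diagonal matrices in $sl_2(D)$ (the graded identities of the pair $(M_2(D),sl_2(D))$). Then $T$ has the Specht property: $T$ is a weak T-ideal, it is finitely generated, and every weak T-ideal containing $T$ is finitely generated. -/

import Mathlib

noncomputable section

namespace WeakSpecht

attribute [local instance 100] LieRing.ofAssociativeRing

/-- The variables: `Sum.inl i` is the even variable `y_i`, `Sum.inr i` is the odd variable `z_i`. -/
abbrev Var : Type := ℕ ⊕ ℕ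

/-- The degree of a variable in `ZMod 2`. -/
def varDeg : Var → ZMod 2
  | Sum.inl _ => 0
  | Sum.inr _ => 1

/-- The even variable `y_i` in the free unital associative algebra `D⟨X⟩`. -/
def y (D : Type*) [CommRing D] (i : ℕ) : FreeAlgebra D Var := FreeAlgebra.ι D (Sum.inl i)

/-- The odd variable `z_i` in the free unital associative algebra `D⟨X⟩`. -/
def z (D : Type*) [CommRing D] (i : ℕ) : FreeAlgebra D Var := FreeAlgebra.ι D (Sum.inr i)

/-- The homogeneous component of degree `g` of `D⟨X⟩`: the span of the monomials (words) `w`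
whose letters have degrees adding up to `g`. -/
def freeComponent (D : Type*) [CommRing D] (g : ZMod 2) : Submodule D (FreeAlgebra D Var) :=
  Submodule.span D
    {m | ∃ w : List Var, (w.map varDeg).sum = g ∧ (w.map (FreeAlgebra.ι D)).prod = m}

/-- `L⟨X⟩`: the Lie subalgebra of `D⟨X⟩` (with the commutator) generated by the variables. -/
def freeLie (D : Type*) [CommRing D] : LieSubalgebra D (FreeAlgebra D Var) :=
  LieSubalgebra.lieSpan D (FreeAlgebra D Var) (Set.range (FreeAlgebra.ι D))

/-- `φ` is a graded endomorphism of the pair `(D⟨X⟩, L⟨X⟩)`. -/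
structure IsGradedPairEnd {D : Type*} [CommRing D]
    (φ : FreeAlgebra D Var →ₐ[D] FreeAlgebra D Var) : Prop where
  map_component : ∀ (g : ZMod 2), ∀ f ∈ freeComponent D g, φ f ∈ freeComponent D g
  map_lie : ∀ f ∈ freeLie D, φ f ∈ freeLie D

/-- A two-sided ideal of `D⟨X⟩` is a weak T-ideal when it is closed under all graded endomorphisms
of the pair `(D⟨X⟩, L⟨X⟩)`. -/
def IsWeakTIdeal {D : Type*} [CommRing D] (J : TwoSidedIdeal (FreeAlgebra D Var)) : Prop :=
  ∀ φ : FreeAlgebra D Var →ₐ[D] FreeAlgebra D Var, IsGradedPairEnd φ → ∀ f ∈ J, φ f ∈ J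

/-- The ideal is homogeneous in the `ZMod 2`-grading: it contains the even and the odd part of each
of its elements. -/
def IsHomogeneousIdeal {D : Type*} [CommRing D] (J : TwoSidedIdeal (FreeAlgebra D Var)) : Prop :=
  ∀ f₀ ∈ freeComponent D 0, ∀ f₁ ∈ freeComponent D 1, f₀ + f₁ ∈ J → f₀ ∈ J ∧ f₁ ∈ J

/-- The weak T-ideal generated by `S`: the intersection of all weak T-ideals containing `S`. -/
def weakTSpan {D : Type*} [CommRing D] (S : Set (FreeAlgebra D Var)) :
    TwoSidedIdeal (FreeAlgebra D Var) :=
  sInf {J | IsWeakTIdeal J ∧ ∀ f ∈ S, f ∈ J}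

/-- `J` is finitely generated as a weak T-ideal. -/
def IsFinGen {D : Type*} [CommRing D] (J : TwoSidedIdeal (FreeAlgebra D Var)) : Prop :=
  ∃ S : Set (FreeAlgebra D Var), S.Finite ∧ weakTSpan S = J

/-- `J` is finitely generated, as a weak T-ideal, by homogeneous elements. -/
def IsHomogeneouslyFinGen {D : Type*} [CommRing D] (J : TwoSidedIdeal (FreeAlgebra D Var)) : Prop :=
  ∃ S : Set (FreeAlgebra D Var), S.Finite ∧ (∀ f ∈ S, ∃ g : ZMod 2, f ∈ freeComponent D g) ∧
    weakTSpan S = J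

/-- The Specht property of a weak T-ideal: it is finitely generated, and so is every weak T-ideal
containing it. -/
def HasSpechtProperty {D : Type*} [CommRing D] (J : TwoSidedIdeal (FreeAlgebra D Var)) : Prop :=
  IsWeakTIdeal J ∧ IsFinGen J ∧
    ∀ K : TwoSidedIdeal (FreeAlgebra D Var), IsWeakTIdeal K → J ≤ K → IsFinGen K

/-- The weak T-ideal generated by `[y₁, y₂] = y₁y₂ - y₂y₁`, `z₁z₂z₃ - z₃z₂z₁` and `yz + zy`. -/
def basicIdeal (D : Type*) [CommRing D] : TwoSidedIdeal (FreeAlgebra D Var) :=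
  weakTSpan {y D 1 * y D 2 - y D 2 * y D 1, z D 1 * z D 2 * z D 3 - z D 3 * z D 2 * z D 1,
    y D 1 * z D 1 + z D 1 * y D 1}

/-- The ideal of graded identities of a pair `(A, L)`, where `𝒜` is the grading of `A`: the
polynomials that vanish whenever each `y_i` is replaced by an element of `L ∩ 𝒜 0` and each
`z_i` by an element of `L ∩ 𝒜 1`. -/
def gradedIdentities {D A : Type*} [CommRing D] [Ring A] [Algebra D A]
    (𝒜 : ZMod 2 → Submodule D A) (L : LieSubalgebra D A) : TwoSidedIdeal (FreeAlgebra D Var) :=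
  ⨅ a : {a : Var → A // ∀ x, a x ∈ L ∧ a x ∈ 𝒜 (varDeg x)},
    TwoSidedIdeal.ker (FreeAlgebra.lift D a.1)

/-- The natural grading of `M₂(D)`: degree `0` is the diagonal matrices, degree `1` the off-diagonal
ones, that is, the matrix unit in position `(i, j)` has degree `i + j` modulo `2`. -/
def matrixGrading (D : Type*) [CommRing D] (g : ZMod 2) :
    Submodule D (Matrix (Fin 2) (Fin 2) D) where
  carrier := {M | ∀ i j : Fin 2, (i.val : ZMod 2) + (j.val : ZMod 2) ≠ g → M i j = 0}
  add_mem' := by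
    intro M N hM hN i j h
    simp [hM i j h, hN i j h]
  zero_mem' := by
    intro i j _
    rfl
  smul_mem' := by
    intro c M hM i j h
    simp [hM i j h]

/-- The ideal of graded identities of the pair `(M₂(D), sl₂(D))`. -/
def slIdentities (D : Type*) [CommRing D] : TwoSidedIdeal (FreeAlgebra D Var) :=
  gradedIdentities (matrixGrading D) (LieAlgebra.SpecialLinear.sl (Fin 2) D)

end WeakSpecht

end

/-!
Modulo the basic ideal `I` the even variables commute with each other and anticommute with the odd
ones, and `z₁z₂z₃ = z₃z₂z₁` makes a product of odd variables depend only on the multiset of the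
factors in odd positions and the multiset of those in even positions. Hence `D⟨X⟩ / I` is spanned
by the words attached to triples of multisets `(t, a, b)` with `|a| - |b| ∈ {0, 1}` (`Monom`,
`exists_sub_normalMap_mem`), and renaming the variables and multiplying from the left by a word of
even length in the `z_i` act on this spanning set by maps of triples (`normalMap_mapDomain_mem`).

A weak T-ideal `J ⊇ I` therefore pulls back to a submodule of the free module on `Monom` that is
closed under these maps. By Higman's lemma the relation "divisible after an increasing renaming" is
a well-quasi-order on triples of either parity, and a quotient of two triples of the same parity is
a word of even length, so it really is realized by a left multiplication
(`Monom.wellQuasiOrdered_shifts`). The maps preserve a colexicographic well-order of the triples.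
So the argument of Hilbert's basis theorem, with divisibility replaced by this well-quasi-order,
shows that the submodule is generated up to symmetry by finitely many elements
(`exists_finite_le_orbitSpan`); together with the generators of `I` they generate `J`. A homogeneous
`J` is generated by the components of its generators.

Finally, the identities of `(M₂(D), sl₂(D))` form a weak T-ideal that contains `I`, by direct
computation.
-/

namespace WeakSpecht

attribute [local instance 100] LieRing.ofAssociativeRing

/-! ### Submodules closed under a monoid of monotone maps -/

/-- In a Noetherian ring every sequence has a term in the ideal generated by the earlier ones. -/
lemma exists_mem_span_image_Iio {R : Type*} [CommRing R] [IsNoetherianRing R] (c : ℕ → R) :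
    ∃ n, c n ∈ Ideal.span (c '' Set.Iio n) := by
  obtain ⟨n, hn⟩ := monotone_stabilizes_iff_noetherian.2 ‹IsNoetherianRing R›
    ⟨fun n => Ideal.span (c '' Set.Iio n), fun i j hij =>
      Ideal.span_mono (Set.image_mono (Set.Iio_subset_Iio hij))⟩
  refine ⟨n, ?_⟩
  have h : Ideal.span (c '' Set.Iio n) = Ideal.span (c '' Set.Iio (n + 1)) := hn (n + 1) n.le_succ
  rw [h]
  exact Ideal.subset_span ⟨n, by simp, rfl⟩

/-- The submodule generated by the images of `S` under the basis maps in `𝒯`. -/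
noncomputable def orbitSpan {R M : Type*} [CommRing R] (𝒯 : Set (M → M)) (S : Set (M →₀ R)) :
    Submodule R (M →₀ R) :=
  Submodule.span R {g | ∃ τ ∈ 𝒯, ∃ f ∈ S, f.mapDomain τ = g}

/-- A Hilbert basis theorem up to symmetry. Let the monoid `𝒯` act on a well-ordered basis `M` by
strictly monotone maps so that the orbit relation is a well-quasi-order. Then a submodule that is
closed under `𝒯` is generated by the `𝒯`-images of finitely many elements. A sequence of
elements, each outside the span of its predecessors with the least possible leading position,
would have a subsequence whose leading positions map to one another; the leading coefficient of
some term is then a combination of the earlier ones, and cancelling it contradicts minimality. -/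
theorem exists_finite_le_orbitSpan {R M : Type*} [CommRing R] [IsNoetherianRing R]
    [LinearOrder M] [WellFoundedLT M] {𝒯 : Set (M → M)} (h_id : id ∈ 𝒯)
    (h_comp : ∀ τ ∈ 𝒯, ∀ υ ∈ 𝒯, υ ∘ τ ∈ 𝒯) (h_mono : ∀ τ ∈ 𝒯, StrictMono τ)
    (h_wqo : WellQuasiOrdered fun m m' : M => ∃ τ ∈ 𝒯, τ m = m')
    (N : Submodule R (M →₀ R)) (hN : ∀ τ ∈ 𝒯, ∀ f ∈ N, f.mapDomain τ ∈ N) :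
    ∃ S : Set (M →₀ R), S.Finite ∧ S ⊆ N ∧ N ≤ orbitSpan 𝒯 S := by
  by_contra! h
  have step : ∀ S : {S : Set (M →₀ R) // S.Finite ∧ S ⊆ N}, ∃ f ∈ N, f ∉ orbitSpan 𝒯 S.1 ∧
      ∃ m, (∀ k, f k ≠ 0 → k ≤ m) ∧ ∀ g ∈ N, g ∉ orbitSpan 𝒯 S.1 →
        ∀ m', (∀ k, g k ≠ 0 → k ≤ m') → m ≤ m' := by
    intro S
    have key : ∃ m, ∃ f ∈ N, f ∉ orbitSpan 𝒯 S.1 ∧ ∀ k, f k ≠ 0 → k ≤ m := by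
      obtain ⟨f, hf, hfS⟩ := SetLike.not_le_iff_exists.1 (h S.1 S.2.1 S.2.2)
      have hne : f.support.Nonempty := by
        rw [Finsupp.support_nonempty_iff]
        rintro rfl
        exact hfS (zero_mem _)
      exact ⟨f.support.max' hne, f, hf, hfS, fun k hk =>
        Finset.le_max' _ _ (Finsupp.mem_support_iff.2 hk)⟩
    obtain ⟨f, hf, hfS, hm⟩ := wellFounded_lt.min_mem {m | ∃ f ∈ N, f ∉ orbitSpan 𝒯 S.1 ∧
      ∀ k, f k ≠ 0 → k ≤ m} key
    exact ⟨f, hf, hfS, _, hm, fun g hg hgS m' hm' =>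
      not_lt.1 (wellFounded_lt.not_lt_min {m | ∃ f ∈ N, f ∉ orbitSpan 𝒯 S.1 ∧
        ∀ k, f k ≠ 0 → k ≤ m} (x := m') ⟨g, hg, hgS, hm'⟩)⟩
  choose f hfN hfS m hm hmin using step
  let T : ℕ → {S : Set (M →₀ R) // S.Finite ∧ S ⊆ N} := fun n =>
    Nat.rec ⟨∅, Set.finite_empty, Set.empty_subset _⟩
      (fun _ S => ⟨insert (f S) S.1, S.2.1.insert _, Set.insert_subset (hfN S) S.2.2⟩) n
  have hT_mono : Monotone fun n => (T n).1 :=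
    monotone_nat_of_le_succ fun n => Set.subset_insert _ _
  have hT : ∀ i j, i < j → f (T i) ∈ (T j).1 := fun i j hij =>
    hT_mono (Nat.succ_le_of_lt hij) (Set.mem_insert _ _)
  have : IsPreorder M fun m m' : M => ∃ τ ∈ 𝒯, τ m = m' :=
    { refl := fun a => ⟨id, h_id, rfl⟩
      trans := by
        rintro a _ _ ⟨τ, hτ, rfl⟩ ⟨υ, hυ, rfl⟩
        exact ⟨υ ∘ τ, h_comp τ hτ υ hυ, rfl⟩ }
  obtain ⟨g, hg⟩ := h_wqo.exists_monotone_subseq fun n => m (T n)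
  obtain ⟨n, hn⟩ := exists_mem_span_image_Iio fun i => f (T (g i)) (m (T (g i)))
  -- The leading coefficient of the `n`-th element is also attained in the span of the earlier ones.
  obtain ⟨e, heN, heT, hem, hec⟩ : ∃ e ∈ N, e ∈ orbitSpan 𝒯 (T (g n)).1 ∧
      (∀ k, e k ≠ 0 → k ≤ m (T (g n))) ∧ e (m (T (g n))) = f (T (g n)) (m (T (g n))) := by
    refine Submodule.span_induction (p := fun c _ => ∃ e ∈ N, e ∈ orbitSpan 𝒯 (T (g n)).1 ∧
      (∀ k, e k ≠ 0 → k ≤ m (T (g n))) ∧ e (m (T (g n))) = c) ?_ ?_ ?_ ?_ hn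
    · rintro _ ⟨i, hi, rfl⟩
      obtain ⟨τ, hτ, hτm⟩ := hg i n (le_of_lt hi)
      refine ⟨(f (T (g i))).mapDomain τ, hN τ hτ _ (hfN _), Submodule.subset_span
        ⟨τ, hτ, _, hT _ _ (g.strictMono hi), rfl⟩, fun k hk => ?_, ?_⟩
      · classical
        obtain ⟨k', hk', rfl⟩ := Finset.mem_image.1
          (Finsupp.mapDomain_support (Finsupp.mem_support_iff.2 hk))
        rw [← hτm]
        exact (h_mono τ hτ).monotone (hm _ _ (Finsupp.mem_support_iff.1 hk'))
      · rw [← hτm, Finsupp.mapDomain_apply (h_mono τ hτ).injective]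
    · exact ⟨0, zero_mem _, zero_mem _, by simp, rfl⟩
    · rintro _ _ _ _ ⟨e, h1, h2, h3, rfl⟩ ⟨e', h1', h2', h3', rfl⟩
      refine ⟨e + e', add_mem h1 h1', add_mem h2 h2', fun k hk => ?_, rfl⟩
      by_cases hk0 : e k = 0
      · exact h3' k fun h0 => hk (by simp [hk0, h0])
      · exact h3 k hk0
    · rintro a _ _ ⟨e, h1, h2, h3, rfl⟩
      exact ⟨a • e, N.smul_mem a h1, Submodule.smul_mem _ a h2,
        fun k hk => h3 k fun h0 => hk (by simp [h0]), rfl⟩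
  set d := f (T (g n)) - e with hd
  have hdS : d ∉ orbitSpan 𝒯 (T (g n)).1 := fun hmem =>
    hfS (T (g n)) (by simpa [hd] using add_mem hmem heT)
  have hne : d.support.Nonempty := by
    rw [Finsupp.support_nonempty_iff]
    intro h0
    exact hdS (h0 ▸ zero_mem _)
  have hle : m (T (g n)) ≤ d.support.max' hne :=
    hmin _ d (sub_mem (hfN _) heN) hdS _ fun k hk =>
      Finset.le_max' _ _ (Finsupp.mem_support_iff.2 hk)
  have hmax := Finsupp.mem_support_iff.1 (d.support.max'_mem hne)
  have hge : d.support.max' hne ≤ m (T (g n)) := by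
    by_cases h0 : e (d.support.max' hne) = 0
    · exact hm _ _ fun h1 => hmax ((Finsupp.sub_apply _ _ _).trans (by rw [h0, h1, sub_zero]))
    · exact hem _ h0
  rw [← le_antisymm hle hge] at hmax
  exact hmax (by simp [hd, hec])

/-! ### Balanced monomials -/

/-- A normal monomial `y_{t₁} y_{t₂} ⋯ z_{a₁} z_{b₁} z_{a₂} z_{b₂} ⋯`, recorded by the multisets of
the indices of its even variables and of its odd variables in odd and in even position. -/
@[ext]
structure Monom where
  /-- the indices of the even variables -/
  t : Multiset ℕ
  /-- the indices of the odd variables in odd position -/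
  a : Multiset ℕ
  /-- the indices of the odd variables in even position -/
  b : Multiset ℕ
  card_le : b.card ≤ a.card
  card_ge : a.card ≤ b.card + 1

namespace Monom

/-- A multiset of indices as an exponent function, ordered by the largest index at which two
functions differ. -/
noncomputable def colexKey (s : Multiset ℕ) : Colex (ℕ →₀ ℕ) := toColex (Multiset.toFinsupp s)

lemma colexKey_injective : Function.Injective colexKey := fun _ _ h =>
  Multiset.toFinsupp.injective (toColex.injective h)

lemma colexKey_lt_iff {s s' : Multiset ℕ} : colexKey s < colexKey s' ↔
    ∃ i, (∀ j, i < j → s.count j = s'.count j) ∧ s.count i < s'.count i := by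
  simp [colexKey, Finsupp.Colex.lt_iff]

lemma colexKey_map_add_strictMono {σ : ℕ → ℕ} (hσ : StrictMono σ) (d : Multiset ℕ)
    {s s' : Multiset ℕ} (h : colexKey s < colexKey s') :
    colexKey (s.map σ + d) < colexKey (s'.map σ + d) := by
  rw [colexKey_lt_iff] at h ⊢
  obtain ⟨i, hi, hlt⟩ := h
  refine ⟨σ i, fun j hj => ?_, ?_⟩
  · by_cases hr : ∃ k, σ k = j
    · obtain ⟨k, rfl⟩ := hr
      simp [Multiset.count_map_eq_count' _ _ hσ.injective, hi k (hσ.lt_iff_lt.1 hj)]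
    · have h0 : ∀ u : Multiset ℕ, (u.map σ).count j = 0 := fun u =>
        Multiset.count_eq_zero.2 fun hu => hr (by
          obtain ⟨k, _, hk⟩ := Multiset.mem_map.1 hu
          exact ⟨k, hk⟩)
      simp [h0]
  · simpa [Multiset.count_map_eq_count' _ _ hσ.injective] using hlt

/-- The three exponent functions, compared lexicographically. -/
noncomputable def key (m : Monom) :
    Colex (ℕ →₀ ℕ) ×ₗ (Colex (ℕ →₀ ℕ) ×ₗ Colex (ℕ →₀ ℕ)) :=
  toLex (colexKey m.t, toLex (colexKey m.a, colexKey m.b))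

lemma key_injective : Function.Injective key := by
  intro m m' h
  simp only [key, EmbeddingLike.apply_eq_iff_eq, Prod.mk.injEq] at h
  exact Monom.ext (colexKey_injective h.1) (colexKey_injective h.2.1) (colexKey_injective h.2.2)

noncomputable instance : LinearOrder Monom := LinearOrder.lift' key key_injective

lemma lt_def {m m' : Monom} : m < m' ↔ key m < key m' := Iff.rfl

instance : WellFoundedLT Monom := ⟨InvImage.wf key wellFounded_lt⟩

/-- Rename the indices of `m` by `σ` and multiply by a monomial of even length in the `z_i`. -/
def shift (σ : ℕ → ℕ) (t a b : Multiset ℕ) (hab : a.card = b.card) (m : Monom) : Monom where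
  t := m.t.map σ + t
  a := m.a.map σ + a
  b := m.b.map σ + b
  card_le := by simpa [hab] using m.card_le
  card_ge := by
    have := m.card_ge
    simp only [Multiset.card_add, Multiset.card_map, hab]
    omega

lemma shift_strictMono {σ : ℕ → ℕ} (hσ : StrictMono σ) (t a b : Multiset ℕ)
    (hab : a.card = b.card) : StrictMono (shift σ t a b hab) := by
  intro m m' h
  rw [lt_def] at h ⊢
  simp only [key, Prod.Lex.toLex_lt_toLex, shift] at h ⊢
  rcases h with h | ⟨h, h' | ⟨h', h''⟩⟩
  · exact Or.inl (colexKey_map_add_strictMono hσ _ h)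
  · exact Or.inr ⟨by rw [colexKey_injective h], Or.inl (colexKey_map_add_strictMono hσ _ h')⟩
  · exact Or.inr ⟨by rw [colexKey_injective h], Or.inr ⟨by rw [colexKey_injective h'],
      colexKey_map_add_strictMono hσ _ h''⟩⟩

/-- The maps of monomials that come from increasing renamings of the variables followed by left
multiplications. -/
def shifts : Set (Monom → Monom) :=
  {τ | ∃ σ : ℕ → ℕ, StrictMono σ ∧ ∃ t a b, ∃ hab : a.card = b.card, shift σ t a b hab = τ}

lemma id_mem_shifts : id ∈ shifts :=
  ⟨id, strictMono_id, 0, 0, 0, rfl, by ext1 m; ext1 <;> simp [shift]⟩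

lemma comp_mem_shifts {τ υ : Monom → Monom} (hτ : τ ∈ shifts) (hυ : υ ∈ shifts) :
    υ ∘ τ ∈ shifts := by
  obtain ⟨σ, hσ, t, a, b, hab, rfl⟩ := hτ
  obtain ⟨σ', hσ', t', a', b', hab', rfl⟩ := hυ
  refine ⟨σ' ∘ σ, hσ'.comp hσ, t.map σ' + t', a.map σ' + a', b.map σ' + b', by simp [hab, hab'], ?_⟩
  ext1 m
  ext1 <;> simp [shift, add_assoc]

/-! ### Well-quasi-ordering of monomials -/

/-- An embedding of lists in the sense of Higman's lemma extends to a strictly increasing map of all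
positions, where a list is continued by the least element. -/
lemma exists_strictMono_getD_le {α : Type*} [PartialOrder α] [OrderBot α] {l l' : List α}
    (h : List.SublistForall₂ (· ≤ ·) l l') :
    ∃ σ : ℕ → ℕ, StrictMono σ ∧ ∀ i, l.getD i ⊥ ≤ l'.getD (σ i) ⊥ := by
  induction h with
  | nil => exact ⟨id, strictMono_id, by simp⟩
  | @cons x x' l l' hx _ ih =>
    obtain ⟨σ, hσ, hle⟩ := ih
    refine ⟨fun i => Nat.casesOn i 0 fun i => σ i + 1, ?_, fun i => ?_⟩
    · refine strictMono_nat_of_lt_succ fun i => ?_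
      cases i with
      | zero => simp
      | succ i => simpa using hσ i.lt_succ_self
    · cases i with
      | zero => simpa using hx
      | succ i => simpa using hle i
  | @cons_right x l l' _ ih =>
    obtain ⟨σ, hσ, hle⟩ := ih
    exact ⟨fun i => σ i + 1, fun i j hij => Nat.succ_lt_succ (hσ hij), fun i => by simpa using hle i⟩

/-- The exponents of the three variables with index `i`. -/
def exponents (m : Monom) (i : ℕ) : ℕ × ℕ × ℕ := (m.t.count i, m.a.count i, m.b.count i)

lemma exists_list_exponents (m : Monom) :
    ∃ l : List (ℕ × ℕ × ℕ), ∀ i, l.getD i ⊥ = m.exponents i := by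
  obtain ⟨n, hn⟩ : ∃ n, ∀ i, ¬ i < n → i ∉ m.t + m.a + m.b :=
    ⟨(m.t + m.a + m.b).sup + 1, fun i hi hmem => hi (Nat.lt_succ_of_le (Multiset.le_sup hmem))⟩
  refine ⟨(List.range n).map m.exponents, fun i => ?_⟩
  by_cases hi : i < n
  · simp [List.getD_eq_getElem?_getD, hi]
  · have h0 := hn i hi
    simp only [Multiset.mem_add, not_or] at h0
    rw [List.getD_eq_default _ _ (by simpa using hi)]
    simp [exponents, h0, Prod.ext_iff]

/-- If the exponents of `m`, renamed by `σ`, are at most those of `m'`, and the two monomials have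
the same parity, then the quotient has even length in the `z_i`. -/
lemma exists_shift_eq {m m' : Monom} {σ : ℕ → ℕ} (hσ : StrictMono σ)
    (hle : ∀ i, m.exponents i ≤ m'.exponents (σ i))
    (hp : m.a.card = m.b.card ↔ m'.a.card = m'.b.card) : ∃ τ ∈ shifts, τ m = m' := by
  have key : ∀ u u' : Multiset ℕ, (∀ i, u.count i ≤ u'.count (σ i)) → u.map σ ≤ u' := by
    intro u u' h
    rw [Multiset.le_iff_count]
    intro j
    by_cases hr : ∃ k, σ k = j
    · obtain ⟨k, rfl⟩ := hr
      simpa [Multiset.count_map_eq_count' _ _ hσ.injective] using h k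
    · rw [Multiset.count_eq_zero.2 fun hu => hr (by
        obtain ⟨k, _, hk⟩ := Multiset.mem_map.1 hu
        exact ⟨k, hk⟩)]
      exact Nat.zero_le _
  obtain ⟨t, ht⟩ := Multiset.le_iff_exists_add.1 (key _ _ fun i => (hle i).1)
  obtain ⟨a, ha⟩ := Multiset.le_iff_exists_add.1 (key _ _ fun i => (hle i).2.1)
  obtain ⟨b, hb⟩ := Multiset.le_iff_exists_add.1 (key _ _ fun i => (hle i).2.2)
  have h₁ := m.card_le
  have h₂ := m.card_ge
  have h₁' := m'.card_le
  have h₂' := m'.card_ge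
  have ha' := congrArg Multiset.card ha
  have hb' := congrArg Multiset.card hb
  simp only [Multiset.card_add, Multiset.card_map] at ha' hb'
  exact ⟨_, ⟨σ, hσ, t, a, b, by omega, rfl⟩, Monom.ext ht.symm ha.symm hb.symm⟩

/-- Higman's lemma for monomials: divisibility up to an increasing renaming is a
well-quasi-order. -/
theorem wellQuasiOrdered_shifts : WellQuasiOrdered fun m m' : Monom => ∃ τ ∈ shifts, τ m = m' := by
  choose l hl using exists_list_exponents
  have hpwo : (Set.univ : Set (ℕ × ℕ × ℕ)).PartiallyWellOrderedOn (· ≤ ·) := fun f =>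
    wellQuasiOrdered_le fun n => (f n).1
  have hlist : WellQuasiOrdered (List.SublistForall₂ (α := ℕ × ℕ × ℕ) (· ≤ ·)) := fun f =>
    hpwo.partiallyWellOrderedOn_sublistForall₂ _ fun n => ⟨f n, fun _ _ => Set.mem_univ _⟩
  have : IsPreorder (List (ℕ × ℕ × ℕ)) (List.SublistForall₂ (· ≤ ·)) := { }
  intro f
  obtain ⟨i, j, hij, h, hp⟩ := hlist.prod (Finite.wellQuasiOrdered (α := Prop) (· = ·))
    fun n => (l (f n), (f n).a.card = (f n).b.card)
  obtain ⟨σ, hσ, hle⟩ := exists_strictMono_getD_le h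
  exact ⟨i, j, hij, exists_shift_eq hσ (fun k => by simpa only [hl] using hle k) (iff_of_eq hp)⟩

end Monom

/-! ### Words in a ring satisfying the basic identities -/

/-- The product `z_{a₁} z_{b₁} z_{a₂} z_{b₂} ⋯` that takes its factors alternately from two lists of
indices, the first of which is as long as the second or longer by one; other pairs of lists give a
truncated product. -/
def altProd {Q : Type*} [Monoid Q] (z : ℕ → Q) : List ℕ → List ℕ → Q
  | [], _ => 1
  | i :: A, B => z i * altProd z B A
termination_by A B => A.length + B.length

/-- The word `y_{t₁} y_{t₂} ⋯ z_{a₁} z_{b₁} z_{a₂} z_{b₂} ⋯`. -/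
def normalProd {Q : Type*} [Monoid Q] (y z : ℕ → Q) (T A B : List ℕ) : Q :=
  (T.map y).prod * altProd z A B

section Monoid

variable {Q : Type*} [Monoid Q]

@[simp]
lemma altProd_nil (z : ℕ → Q) (B : List ℕ) : altProd z [] B = 1 := by
  rw [altProd]

@[simp]
lemma altProd_cons (z : ℕ → Q) (i : ℕ) (A B : List ℕ) :
    altProd z (i :: A) B = z i * altProd z B A := by
  rw [altProd]

lemma map_altProd {Q' : Type*} [Monoid Q'] (φ : Q →* Q') (z : ℕ → Q) (A B : List ℕ) :
    φ (altProd z A B) = altProd (φ ∘ z) A B := by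
  induction A, B using altProd.induct with
  | case1 => simp
  | case2 i A B ih => simp [ih]

lemma altProd_map (z : ℕ → Q) (σ : ℕ → ℕ) (A B : List ℕ) :
    altProd z (A.map σ) (B.map σ) = altProd (z ∘ σ) A B := by
  induction A, B using altProd.induct with
  | case1 => simp
  | case2 i A B ih => simp [ih]

lemma map_normalProd {Q' : Type*} [Monoid Q'] (φ : Q →* Q') (y z : ℕ → Q) (T A B : List ℕ) :
    φ (normalProd y z T A B) = normalProd (φ ∘ y) (φ ∘ z) T A B := by
  simp [normalProd, map_altProd, map_list_prod]

lemma normalProd_map (y z : ℕ → Q) (σ : ℕ → ℕ) (T A B : List ℕ) :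
    normalProd y z (T.map σ) (A.map σ) (B.map σ) = normalProd (y ∘ σ) (z ∘ σ) T A B := by
  simp [normalProd, altProd_map]

lemma altProd_append (z : ℕ → Q) {A B : List ℕ} (h : A.length = B.length) (A' B' : List ℕ) :
    altProd z (A ++ A') (B ++ B') = altProd z A B * altProd z A' B' := by
  induction A generalizing B with
  | nil =>
    obtain rfl : B = [] := List.length_eq_zero_iff.1 h.symm
    simp
  | cons a A ih =>
    cases B with
    | nil => simp at h
    | cons b B => simp [ih (Nat.succ_injective h), mul_assoc]

/-- The identity `z₁z₂z₃ = z₃z₂z₁` lets the factors in odd positions be permuted. -/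
lemma altProd_perm_left {z : ℕ → Q} (hz : ∀ i j k, z i * z j * z k = z k * z j * z i)
    {A A' : List ℕ} (hA : A.Perm A') {B : List ℕ} (h₁ : B.length ≤ A.length)
    (h₂ : A.length ≤ B.length + 1) : altProd z A B = altProd z A' B := by
  induction hA generalizing B with
  | nil => rfl
  | cons x hA ih =>
    cases B with
    | nil =>
      obtain rfl := List.length_eq_zero_iff.1 (by simpa using h₂)
      obtain rfl := hA.nil_eq
      rfl
    | cons b B =>
      simp only [altProd_cons]
      rw [ih (by simpa using h₁) (by simpa using h₂)]
  | swap x x' l =>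
    cases B with
    | nil => simp at h₂
    | cons b B => simp only [altProd_cons, ← mul_assoc, hz]
  | trans hA _ ih₁ ih₂ =>
    rw [ih₁ h₁ h₂, ih₂ (hA.length_eq ▸ h₁) (hA.length_eq ▸ h₂)]

lemma altProd_perm_right {z : ℕ → Q} (hz : ∀ i j k, z i * z j * z k = z k * z j * z i)
    {A B B' : List ℕ} (hB : B.Perm B') (h₁ : B.length ≤ A.length)
    (h₂ : A.length ≤ B.length + 1) : altProd z A B = altProd z A B' := by
  cases A with
  | nil => simp
  | cons a A =>
    rw [altProd_cons, altProd_cons, altProd_perm_left hz hB (by simpa using h₂) (by simpa using h₁)]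

end Monoid

/-- The families `y` and `z` satisfy the identities that generate the basic ideal. -/
structure BasicRelations {Q : Type*} [Ring Q] (y z : ℕ → Q) : Prop where
  comm : ∀ i j, y i * y j = y j * y i
  swap : ∀ i j k, z i * z j * z k = z k * z j * z i
  anti : ∀ i j, y i * z j = -(z j * y i)

namespace BasicRelations

variable {Q : Type*} [Ring Q] {y z : ℕ → Q}

lemma normalProd_perm (h : BasicRelations y z) {T T' A A' B B' : List ℕ} (hT : T.Perm T')
    (hA : A.Perm A') (hB : B.Perm B') (h₁ : B.length ≤ A.length) (h₂ : A.length ≤ B.length + 1) :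
    normalProd y z T A B = normalProd y z T' A' B' := by
  rw [normalProd, normalProd, altProd_perm_left h.swap hA h₁ h₂,
    altProd_perm_right h.swap hB (hA.length_eq ▸ h₁) (hA.length_eq ▸ h₂)]
  congr 1
  refine (hT.map y).prod_eq' ?_
  rw [List.pairwise_map]
  exact List.pairwise_of_forall fun i j => h.comm i j

lemma commute_altProd (h : BasicRelations y z) (i : ℕ) {A B : List ℕ}
    (hAB : A.length = B.length) : Commute (y i) (altProd z A B) := by
  induction A generalizing B with
  | nil => simp
  | cons a A ih =>
    cases B with
    | nil => simp at hAB
    | cons b B =>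
      have hab : Commute (y i) (z a * z b) := by
        rw [Commute, SemiconjBy, ← mul_assoc, h.anti, neg_mul, mul_assoc, h.anti]
        simp [mul_assoc]
      simpa [mul_assoc] using hab.mul_right (ih (Nat.succ_injective hAB))

/-- Left multiplication by a word of even length in the `z_i` adds exponents. -/
lemma normalProd_append (h : BasicRelations y z) {A B : List ℕ} (hAB : A.length = B.length)
    (T T' A' B' : List ℕ) : normalProd y z (T ++ T') (A ++ A') (B ++ B') =
      normalProd y z T A B * normalProd y z T' A' B' := by
  have hc : Commute (T'.map y).prod (altProd z A B) :=
    Commute.list_prod_left _ _ (by simpa using fun i _ => h.commute_altProd i hAB)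
  simp only [normalProd, List.map_append, List.prod_append, altProd_append z hAB, mul_assoc]
  rw [← mul_assoc (altProd z A B), ← hc.eq, mul_assoc]

/-- Left multiplication by `z_i` interchanges odd and even positions, up to a sign. -/
lemma mul_normalProd (h : BasicRelations y z) (i : ℕ) (T A B : List ℕ) :
    z i * normalProd y z T A B = normalProd y z T (i :: B) A ∨
      z i * normalProd y z T A B = -normalProd y z T (i :: B) A := by
  have key : z i * (T.map y).prod = (T.map y).prod * z i ∨
      z i * (T.map y).prod = -((T.map y).prod * z i) := by
    induction T with
    | nil => simp
    | cons t T ih =>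
      have ht : z i * y t = -(y t * z i) := by rw [h.anti, neg_neg]
      simp only [List.map_cons, List.prod_cons, ← mul_assoc, ht]
      rcases ih with ih | ih
      · right
        rw [neg_mul, mul_assoc, ih, mul_assoc]
      · left
        rw [neg_mul, mul_assoc, ih, mul_neg, neg_neg, mul_assoc]
  simp only [normalProd, altProd_cons, ← mul_assoc]
  rcases key with key | key
  · left
    rw [key]
  · right
    rw [key, neg_mul]

end BasicRelations

/-! ### Graded endomorphisms and weak T-ideals -/

section WeakT

variable {D : Type*} [CommRing D]

lemma mem_weakTSpan {S : Set (FreeAlgebra D Var)} {f : FreeAlgebra D Var} :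
    f ∈ weakTSpan S ↔ ∀ J, IsWeakTIdeal J → (∀ g ∈ S, g ∈ J) → f ∈ J := by
  simp [weakTSpan, TwoSidedIdeal.mem_sInf]

lemma subset_weakTSpan {S : Set (FreeAlgebra D Var)} {f : FreeAlgebra D Var} (hf : f ∈ S) :
    f ∈ weakTSpan S :=
  mem_weakTSpan.2 fun _ _ hS => hS f hf

lemma weakTSpan_le {S : Set (FreeAlgebra D Var)} {J : TwoSidedIdeal (FreeAlgebra D Var)}
    (hJ : IsWeakTIdeal J) (hS : ∀ f ∈ S, f ∈ J) : weakTSpan S ≤ J :=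
  fun _ hf => mem_weakTSpan.1 hf J hJ hS

lemma isWeakTIdeal_weakTSpan (S : Set (FreeAlgebra D Var)) : IsWeakTIdeal (weakTSpan S) :=
  fun φ hφ f hf => mem_weakTSpan.2 fun J hJ hS => hJ φ hφ f (mem_weakTSpan.1 hf J hJ hS)

lemma smul_mem_twoSidedIdeal {A : Type*} [Ring A] [Algebra D A] (J : TwoSidedIdeal A) (c : D)
    {x : A} (hx : x ∈ J) : c • x ∈ J := by
  rw [Algebra.smul_def]
  exact J.mul_mem_left _ _ hx

/-- A two-sided ideal of a `D`-algebra as a `D`-submodule. -/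
def idealSubmodule {A : Type*} [Ring A] [Algebra D A] (J : TwoSidedIdeal A) : Submodule D A where
  carrier := J
  add_mem' := J.add_mem
  zero_mem' := J.zero_mem
  smul_mem' c _ := smul_mem_twoSidedIdeal J c

@[simp]
lemma mem_idealSubmodule {A : Type*} [Ring A] [Algebra D A] {J : TwoSidedIdeal A} {x : A} :
    x ∈ idealSubmodule (D := D) J ↔ x ∈ J := Iff.rfl

lemma mk_eq_mk_iff_sub_mem {A : Type*} [Ring A] (J : TwoSidedIdeal A) (x x' : A) :
    J.ringCon.mk' x = J.ringCon.mk' x' ↔ x - x' ∈ J :=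
  (RingCon.eq _).trans (J.rel_iff x x')

/-- A homomorphism maps words of degree `g` into the component of degree `g` of a graded algebra
as soon as it does so for the variables. -/
lemma map_mem_of_mem_freeComponent {A : Type*} [Ring A] [Algebra D A]
    (𝒜 : ZMod 2 → Submodule D A) (h_one : 1 ∈ 𝒜 0)
    (h_mul : ∀ g h, ∀ u ∈ 𝒜 g, ∀ v ∈ 𝒜 h, u * v ∈ 𝒜 (g + h)) (φ : FreeAlgebra D Var →ₐ[D] A)
    (hφ : ∀ x, φ (FreeAlgebra.ι D x) ∈ 𝒜 (varDeg x)) {g : ZMod 2} {f : FreeAlgebra D Var}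
    (hf : f ∈ freeComponent D g) : φ f ∈ 𝒜 g := by
  have hle : freeComponent D g ≤ (𝒜 g).comap φ.toLinearMap := by
    refine Submodule.span_le.2 ?_
    rintro _ ⟨w, rfl, rfl⟩
    simp only [SetLike.mem_coe, Submodule.mem_comap, AlgHom.toLinearMap_apply]
    clear hf
    induction w with
    | nil => simpa using h_one
    | cons x w ih => simpa using h_mul _ _ _ (hφ x) _ ih
  exact hle hf

lemma map_mem_of_mem_freeLie {A : Type*} [Ring A] [Algebra D A] (L : LieSubalgebra D A)
    (φ : FreeAlgebra D Var →ₐ[D] A) (hφ : ∀ x, φ (FreeAlgebra.ι D x) ∈ L)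
    {f : FreeAlgebra D Var} (hf : f ∈ freeLie D) : φ f ∈ L := by
  induction hf using LieSubalgebra.lieSpan_induction with
  | mem f hf =>
    obtain ⟨x, rfl⟩ := hf
    exact hφ x
  | zero => simp
  | add f g _ _ hf hg => simpa using add_mem hf hg
  | smul c f _ hf => simpa using L.smul_mem c hf
  | lie f g _ _ hf hg => simpa [LieRing.of_associative_ring_bracket] using L.lie_mem hf hg

/-- The endomorphism that renames the even variables by `σ` and the odd variables by `ρ`. -/
def rename (D : Type*) [CommRing D] (σ ρ : ℕ → ℕ) : FreeAlgebra D Var →ₐ[D] FreeAlgebra D Var :=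
  FreeAlgebra.lift D (FreeAlgebra.ι D ∘ Sum.map σ ρ)

@[simp]
lemma rename_y (σ ρ : ℕ → ℕ) (i : ℕ) : rename D σ ρ (y D i) = y D (σ i) := by
  simp [rename, y]

@[simp]
lemma rename_z (σ ρ : ℕ → ℕ) (i : ℕ) : rename D σ ρ (z D i) = z D (ρ i) := by
  simp [rename, z]

lemma one_mem_freeComponent : (1 : FreeAlgebra D Var) ∈ freeComponent D 0 :=
  Submodule.subset_span ⟨[], by simp⟩

lemma ι_mem_freeComponent (x : Var) : FreeAlgebra.ι D x ∈ freeComponent D (varDeg x) :=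
  Submodule.subset_span ⟨[x], by simp⟩

lemma mul_mem_freeComponent (g h : ZMod 2) : ∀ u ∈ freeComponent D g, ∀ v ∈ freeComponent D h,
    u * v ∈ freeComponent D (g + h) := by
  intro u hu v hv
  have huv := Submodule.mul_mem_mul hu hv
  rw [freeComponent, freeComponent, Submodule.span_mul_span] at huv
  refine Submodule.span_mono ?_ huv
  rintro _ ⟨_, ⟨w, rfl, rfl⟩, _, ⟨w', rfl, rfl⟩, rfl⟩
  exact ⟨w ++ w', by simp⟩

lemma isGradedPairEnd_rename (σ ρ : ℕ → ℕ) : IsGradedPairEnd (rename D σ ρ) where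
  map_component g f hf := by
    refine map_mem_of_mem_freeComponent _ one_mem_freeComponent mul_mem_freeComponent _ ?_ hf
    rintro (i | i)
    · simpa [rename, varDeg] using ι_mem_freeComponent (D := D) (Sum.inl (σ i))
    · simpa [rename, varDeg] using ι_mem_freeComponent (D := D) (Sum.inr (ρ i))
  map_lie f hf := by
    refine map_mem_of_mem_freeLie _ _ (fun x => ?_) hf
    rw [rename, FreeAlgebra.lift_ι_apply]
    exact LieSubalgebra.subset_lieSpan (Set.mem_range_self _)

/-- Every polynomial is the sum of an even and an odd one. -/
lemma exists_even_add_odd (f : FreeAlgebra D Var) :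
    ∃ f₀ ∈ freeComponent D 0, ∃ f₁ ∈ freeComponent D 1, f₀ + f₁ = f := by
  rw [← Submodule.mem_sup]
  have key : ∀ g : ZMod 2, freeComponent D g ≤ freeComponent D 0 ⊔ freeComponent D 1 := by
    intro g
    fin_cases g
    · exact le_sup_left
    · exact le_sup_right
  induction f using FreeAlgebra.induction with
  | grade0 c =>
    rw [Algebra.algebraMap_eq_smul_one]
    exact Submodule.smul_mem _ c (key 0 one_mem_freeComponent)
  | grade1 x => exact key _ (ι_mem_freeComponent x)
  | mul f g hf hg =>
    obtain ⟨f₀, hf₀, f₁, hf₁, rfl⟩ := Submodule.mem_sup.1 hf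
    obtain ⟨g₀, hg₀, g₁, hg₁, rfl⟩ := Submodule.mem_sup.1 hg
    rw [add_mul, mul_add, mul_add]
    exact add_mem
      (add_mem (key _ (mul_mem_freeComponent _ _ _ hf₀ _ hg₀))
        (key _ (mul_mem_freeComponent _ _ _ hf₀ _ hg₁)))
      (add_mem (key _ (mul_mem_freeComponent _ _ _ hf₁ _ hg₀))
        (key _ (mul_mem_freeComponent _ _ _ hf₁ _ hg₁)))
  | add f g hf hg => exact add_mem hf hg

/-- The homogeneous components of a finite generating set of a homogeneous weak T-ideal generate
it. -/
lemma IsFinGen.isHomogeneouslyFinGen {J : TwoSidedIdeal (FreeAlgebra D Var)} (hJ : IsWeakTIdeal J)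
    (hom : IsHomogeneousIdeal J) (h : IsFinGen J) : IsHomogeneouslyFinGen J := by
  obtain ⟨S, hS, rfl⟩ := h
  choose p₀ hp₀ p₁ hp₁ hp using exists_even_add_odd (D := D)
  refine ⟨p₀ '' S ∪ p₁ '' S, (hS.image _).union (hS.image _), ?_, le_antisymm ?_ ?_⟩
  · rintro _ (⟨f, _, rfl⟩ | ⟨f, _, rfl⟩)
    exacts [⟨0, hp₀ f⟩, ⟨1, hp₁ f⟩]
  · have hmem : ∀ f ∈ S, p₀ f ∈ weakTSpan S ∧ p₁ f ∈ weakTSpan S := fun f hf =>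
      hom _ (hp₀ f) _ (hp₁ f) ((hp f).symm ▸ subset_weakTSpan hf)
    refine weakTSpan_le hJ ?_
    rintro _ (⟨f, hf, rfl⟩ | ⟨f, hf, rfl⟩)
    exacts [(hmem f hf).1, (hmem f hf).2]
  · refine weakTSpan_le (isWeakTIdeal_weakTSpan _) fun f hf => ?_
    rw [← hp f]
    exact TwoSidedIdeal.add_mem _ (subset_weakTSpan (Or.inl ⟨f, hf, rfl⟩))
      (subset_weakTSpan (Or.inr ⟨f, hf, rfl⟩))

/-! ### Normal forms modulo the basic ideal -/

/-- The polynomials that generate the basic ideal. -/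
def basicGenerators (D : Type*) [CommRing D] : Set (FreeAlgebra D Var) :=
  {y D 1 * y D 2 - y D 2 * y D 1, z D 1 * z D 2 * z D 3 - z D 3 * z D 2 * z D 1,
    y D 1 * z D 1 + z D 1 * y D 1}

lemma basicRelations {J : TwoSidedIdeal (FreeAlgebra D Var)} (hJ : IsWeakTIdeal J)
    (hle : basicIdeal D ≤ J) :
    BasicRelations (fun i => J.ringCon.mk' (y D i)) (fun i => J.ringCon.mk' (z D i)) := by
  have hgen : ∀ f ∈ basicGenerators D, f ∈ J := fun f hf => hle (subset_weakTSpan hf)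
  constructor
  · intro i j
    have h : y D i * y D j - y D j * y D i ∈ J := by
      simpa using hJ _ (isGradedPairEnd_rename (fun n => if n = 1 then i else j) id) _
        (hgen _ (Or.inl rfl))
    simpa only [map_mul] using (mk_eq_mk_iff_sub_mem J _ _).2 h
  · intro i j k
    have h : z D i * z D j * z D k - z D k * z D j * z D i ∈ J := by
      simpa using hJ _ (isGradedPairEnd_rename id fun n => if n = 1 then i else if n = 2 then j else k)
        _ (hgen _ (Or.inr (Or.inl rfl)))
    simpa only [map_mul] using (mk_eq_mk_iff_sub_mem J _ _).2 h
  · intro i j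
    have h : y D i * z D j - -(z D j * y D i) ∈ J := by
      simpa using hJ _ (isGradedPairEnd_rename (fun _ => i) fun _ => j) _
        (hgen _ (Or.inr (Or.inr rfl)))
    simpa only [map_mul, map_neg] using (mk_eq_mk_iff_sub_mem J _ _).2 h

/-- A word with the exponents of `m`; the order of the variables within each multiset is arbitrary,
and it does not matter modulo the basic ideal. -/
noncomputable def normalWord (D : Type*) [CommRing D] (m : Monom) : FreeAlgebra D Var :=
  normalProd (y D) (z D) m.t.toList m.a.toList m.b.toList

/-- The linear map that sends each monomial to a word with these exponents. -/
noncomputable def normalMap (D : Type*) [CommRing D] : (Monom →₀ D) →ₗ[D] FreeAlgebra D Var :=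
  Finsupp.linearCombination D (normalWord D)

variable {J : TwoSidedIdeal (FreeAlgebra D Var)}

lemma mk_normalProd (T A B : List ℕ) : J.ringCon.mk' (normalProd (y D) (z D) T A B) =
    normalProd (fun i => J.ringCon.mk' (y D i)) (fun i => J.ringCon.mk' (z D i)) T A B :=
  map_normalProd (J.ringCon.mk' : FreeAlgebra D Var →* J.ringCon.Quotient) _ _ T A B

/-- Modulo the basic ideal, a word depends only on its exponents. -/
lemma mk_normalWord_eq (hJ : IsWeakTIdeal J) (hle : basicIdeal D ≤ J) {m : Monom} {T A B : List ℕ}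
    (hT : m.t = T) (hA : m.a = A) (hB : m.b = B) :
    J.ringCon.mk' (normalWord D m) = J.ringCon.mk' (normalProd (y D) (z D) T A B) := by
  rw [normalWord, mk_normalProd, mk_normalProd]
  refine (basicRelations hJ hle).normalProd_perm ?_ ?_ ?_ ?_ ?_
  · rw [← Multiset.coe_eq_coe, Multiset.coe_toList, hT]
  · rw [← Multiset.coe_eq_coe, Multiset.coe_toList, hA]
  · rw [← Multiset.coe_eq_coe, Multiset.coe_toList, hB]
  · simpa using m.card_le
  · simpa using m.card_ge

/-- Every polynomial is congruent to a combination of normal words. -/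
lemma exists_sub_normalMap_mem (hJ : IsWeakTIdeal J) (hle : basicIdeal D ≤ J)
    (f : FreeAlgebra D Var) : ∃ n, f - normalMap D n ∈ J := by
  set W : Submodule D (FreeAlgebra D Var) := LinearMap.range (normalMap D) ⊔ idealSubmodule J
    with hW
  have hword : ∀ m, normalWord D m ∈ W := fun m =>
    Submodule.mem_sup_left ⟨Finsupp.single m 1, by simp [normalMap]⟩
  have hcongr : ∀ u v, J.ringCon.mk' u = J.ringCon.mk' v → v ∈ W → u ∈ W := fun u v huv hv => by
    simpa using add_mem (Submodule.mem_sup_right (mem_idealSubmodule.2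
      ((mk_eq_mk_iff_sub_mem J u v).1 huv))) hv
  have hgen : ∀ x : Var, ∀ m : Monom, FreeAlgebra.ι D x * normalWord D m ∈ W := by
    rintro (i | i) m
    · let m' : Monom := ⟨i ::ₘ m.t, m.a, m.b, m.card_le, m.card_ge⟩
      refine hcongr _ (normalWord D m') ?_ (hword m')
      rw [mk_normalWord_eq hJ hle (m := m') (T := i :: m.t.toList) (A := m.a.toList)
        (B := m.b.toList) (by simp [m', ← Multiset.cons_coe]) (by simp [m']) (by simp [m'])]
      simp [normalWord, normalProd, y, mul_assoc]
    · let m' : Monom := ⟨m.t, i ::ₘ m.b, m.a, by simpa using m.card_ge, by simpa using m.card_le⟩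
      have hm' := mk_normalWord_eq hJ hle (m := m') (T := m.t.toList) (A := i :: m.b.toList)
        (B := m.a.toList) (by simp [m']) (by simp [m', ← Multiset.cons_coe]) (by simp [m'])
      rw [mk_normalProd] at hm'
      have hmk : J.ringCon.mk' (FreeAlgebra.ι D (Sum.inr i) * normalWord D m) =
          J.ringCon.mk' (z D i) * normalProd (fun i => J.ringCon.mk' (y D i))
            (fun i => J.ringCon.mk' (z D i)) m.t.toList m.a.toList m.b.toList := by
        rw [map_mul, normalWord, mk_normalProd, z]
      rcases (basicRelations hJ hle).mul_normalProd i m.t.toList m.a.toList m.b.toList with h | h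
      · exact hcongr _ (normalWord D m') (by rw [hmk, h, hm']) (hword m')
      · exact hcongr _ (-normalWord D m') (by rw [hmk, h, map_neg, hm']) (neg_mem (hword m'))
  -- As `W` contains `1` and is closed under left multiplication by variables, it is everything.
  have hmul : ∀ f : FreeAlgebra D Var, ∀ w ∈ W, f * w ∈ W := by
    intro f
    induction f using FreeAlgebra.induction with
    | grade0 c =>
      intro w hw
      rw [← Algebra.smul_def]
      exact W.smul_mem c hw
    | grade1 x =>
      have hxW : W ≤ W.comap (LinearMap.mulLeft D (FreeAlgebra.ι D x)) := by
        rw [hW, sup_le_iff, ← hW]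
        constructor
        · rw [normalMap, Finsupp.range_linearCombination, Submodule.span_le]
          rintro _ ⟨m, rfl⟩
          exact hgen x m
        · exact fun j hj => Submodule.mem_sup_right (J.mul_mem_left _ _ hj)
      exact fun w hw => hxW hw
    | mul f g hf hg =>
      intro w hw
      rw [mul_assoc]
      exact hf _ (hg w hw)
    | add f g hf hg =>
      intro w hw
      rw [add_mul]
      exact add_mem (hf w hw) (hg w hw)
  have hone : (1 : FreeAlgebra D Var) ∈ W := by
    refine hcongr _ (normalWord D ⟨0, 0, 0, by simp, by simp⟩) ?_ (hword _)
    simp [normalWord, normalProd]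
  have hf := hmul f 1 hone
  rw [mul_one, hW, Submodule.mem_sup] at hf
  obtain ⟨_, ⟨n, rfl⟩, j, hj, rfl⟩ := hf
  exact ⟨n, by simpa using hj⟩

/-- A shift of monomials acts as a renaming followed by left multiplication by a word. -/
lemma normalMap_mapDomain_mem (hJ : IsWeakTIdeal J) (hle : basicIdeal D ≤ J) {τ : Monom → Monom}
    (hτ : τ ∈ Monom.shifts) {n : Monom →₀ D} (hn : normalMap D n ∈ J) :
    normalMap D (n.mapDomain τ) ∈ J := by
  obtain ⟨σ, hσ, t, a, b, hab, rfl⟩ := hτ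
  set u := normalProd (y D) (z D) t.toList a.toList b.toList with hu
  have hword : ∀ m, normalWord D (m.shift σ t a b hab) - u * rename D σ σ (normalWord D m) ∈ J := by
    intro m
    have hren : rename D σ σ (normalWord D m) = normalProd (y D) (z D) (m.t.toList.map σ)
        (m.a.toList.map σ) (m.b.toList.map σ) := by
      have h := map_normalProd (rename D σ σ : FreeAlgebra D Var →* FreeAlgebra D Var) (y D) (z D)
        m.t.toList m.a.toList m.b.toList
      rw [normalProd_map, normalWord]
      refine h.trans ?_
      congr 1 <;> ext i <;> simp
    rw [← mk_eq_mk_iff_sub_mem, map_mul, hren, hu, mk_normalProd, mk_normalProd,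
      ← (basicRelations hJ hle).normalProd_append (by simpa using hab), ← mk_normalProd]
    apply mk_normalWord_eq hJ hle <;>
      simp [Monom.shift, ← Multiset.coe_add, ← Multiset.map_coe, add_comm]
  have key : ∀ n : Monom →₀ D, normalMap D (n.mapDomain (Monom.shift σ t a b hab)) -
      u * rename D σ σ (normalMap D n) ∈ J := by
    intro n
    induction n using Finsupp.induction_linear with
    | zero => simp [J.zero_mem]
    | add n n' hn hn' =>
      rw [Finsupp.mapDomain_add, map_add, map_add, map_add, mul_add, add_sub_add_comm]
      exact J.add_mem hn hn'
    | single m c =>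
      simpa [normalMap, Finsupp.mapDomain_single, smul_sub] using
        smul_mem_twoSidedIdeal J c (hword m)
  simpa using J.add_mem (key n) (J.mul_mem_left u _ (hJ _ (isGradedPairEnd_rename σ σ) _ hn))

/-- Over a Noetherian ring, the weak T-ideals that contain the basic ideal are finitely
generated. -/
theorem isFinGen_of_basicIdeal_le [IsNoetherianRing D] (hJ : IsWeakTIdeal J)
    (hle : basicIdeal D ≤ J) : IsFinGen J := by
  obtain ⟨S, hS, hSJ, hJS⟩ := exists_finite_le_orbitSpan Monom.id_mem_shifts
    (fun _ hτ _ hυ => Monom.comp_mem_shifts hτ hυ)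
    (by rintro _ ⟨σ, hσ, t, a, b, hab, rfl⟩; exact Monom.shift_strictMono hσ t a b hab)
    Monom.wellQuasiOrdered_shifts ((idealSubmodule J).comap (normalMap D))
    (fun τ hτ n hn => normalMap_mapDomain_mem hJ hle hτ hn)
  refine ⟨normalMap D '' S ∪ basicGenerators D,
    (hS.image _).union (by simp [basicGenerators]), le_antisymm (weakTSpan_le hJ ?_) ?_⟩
  · rintro _ (⟨n, hn, rfl⟩ | hf)
    exacts [hSJ hn, hle (subset_weakTSpan hf)]
  · set K := weakTSpan (normalMap D '' S ∪ basicGenerators D)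
    have hK : IsWeakTIdeal K := isWeakTIdeal_weakTSpan _
    have hleK : basicIdeal D ≤ K := weakTSpan_le hK fun f hf => subset_weakTSpan (Or.inr hf)
    have hspan : orbitSpan Monom.shifts S ≤ (idealSubmodule K).comap (normalMap D) := by
      refine Submodule.span_le.2 ?_
      rintro _ ⟨τ, hτ, n, hn, rfl⟩
      exact normalMap_mapDomain_mem hK hleK hτ (subset_weakTSpan (Or.inl ⟨n, hn, rfl⟩))
    intro f hf
    obtain ⟨n, hn⟩ := exists_sub_normalMap_mem (isWeakTIdeal_weakTSpan _) le_rfl f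
    have hnJ : normalMap D n ∈ J := by simpa using J.sub_mem hf (hle hn)
    have hnK : normalMap D n ∈ K := hspan (hJS hnJ)
    simpa using K.add_mem (hleK hn) hnK

/-! ### The identities of the pair of two-by-two matrices -/

lemma one_mem_matrixGrading : 1 ∈ matrixGrading D 0 := by
  intro i j h
  refine Matrix.one_apply_ne ?_
  rintro rfl
  exact h (CharTwo.add_self_eq_zero _)

lemma mul_mem_matrixGrading (g h : ZMod 2) : ∀ u ∈ matrixGrading D g, ∀ v ∈ matrixGrading D h,
    u * v ∈ matrixGrading D (g + h) := by
  intro u hu v hv i j hij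
  rw [Matrix.mul_apply]
  refine Finset.sum_eq_zero fun k _ => ?_
  by_cases hg : (i.val : ZMod 2) + (k.val : ZMod 2) = g
  · rw [hv k j, mul_zero]
    rintro rfl
    apply hij
    rw [← hg, add_assoc, ← add_assoc (k.val : ZMod 2) (k.val : ZMod 2), CharTwo.add_self_eq_zero,
      zero_add]
  · rw [hu i k hg, zero_mul]

lemma mem_slIdentities {f : FreeAlgebra D Var} : f ∈ slIdentities D ↔
    ∀ a : Var → Matrix (Fin 2) (Fin 2) D,
      (∀ x, a x ∈ LieAlgebra.SpecialLinear.sl (Fin 2) D ∧ a x ∈ matrixGrading D (varDeg x)) →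
        FreeAlgebra.lift D a f = 0 := by
  simp [slIdentities, gradedIdentities, TwoSidedIdeal.mem_iInf, TwoSidedIdeal.mem_ker]

lemma isWeakTIdeal_slIdentities : IsWeakTIdeal (slIdentities D) := by
  intro φ hφ f hf
  rw [mem_slIdentities] at hf ⊢
  intro a ha
  have h := hf (fun x => FreeAlgebra.lift D a (φ (FreeAlgebra.ι D x))) fun x =>
    ⟨map_mem_of_mem_freeLie _ _ (fun x => by simpa using (ha x).1)
        (hφ.map_lie _ (LieSubalgebra.subset_lieSpan (Set.mem_range_self x))),
      map_mem_of_mem_freeComponent _ one_mem_matrixGrading mul_mem_matrixGrading _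
        (fun x => by simpa using (ha x).2) (hφ.map_component _ _ (ι_mem_freeComponent x))⟩
  rw [← h, ← AlgHom.comp_apply]
  congr 1
  ext x
  simp

lemma basicIdeal_le_slIdentities : basicIdeal D ≤ slIdentities D := by
  refine weakTSpan_le isWeakTIdeal_slIdentities fun f hf => ?_
  rw [mem_slIdentities]
  intro a ha
  have hy : ∀ i, a (Sum.inl i) = !![a (Sum.inl i) 0 0, 0; 0, -a (Sum.inl i) 0 0] := by
    intro i
    have htr : a (Sum.inl i) 0 0 + a (Sum.inl i) 1 1 = 0 := by
      rw [← Matrix.trace_fin_two]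
      exact (ha (Sum.inl i)).1
    ext k l
    fin_cases k <;> fin_cases l
    · rfl
    · exact (ha (Sum.inl i)).2 0 1 (by simp [varDeg])
    · exact (ha (Sum.inl i)).2 1 0 (by simp [varDeg])
    · exact eq_neg_of_add_eq_zero_right htr
  have hz : ∀ i, a (Sum.inr i) = !![0, a (Sum.inr i) 0 1; a (Sum.inr i) 1 0, 0] := by
    intro i
    ext k l
    fin_cases k <;> fin_cases l
    · exact (ha (Sum.inr i)).2 0 0 (by simp [varDeg])
    · rfl
    · rfl
    · exact (ha (Sum.inr i)).2 1 1 (by simp [varDeg, CharTwo.add_self_eq_zero])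
  rcases hf with rfl | rfl | rfl
  · simp only [y, map_sub, map_mul, FreeAlgebra.lift_ι_apply]
    rw [hy 1, hy 2]
    ext k l
    fin_cases k <;> fin_cases l <;> simp [mul_comm]
  · simp only [z, map_sub, map_mul, FreeAlgebra.lift_ι_apply]
    rw [hz 1, hz 2, hz 3]
    ext k l
    fin_cases k <;> fin_cases l <;> simp <;> ring
  · simp only [y, z, map_add, map_mul, FreeAlgebra.lift_ι_apply]
    rw [hy 1, hz 1]
    ext k l
    fin_cases k <;> fin_cases l <;> simp [mul_comm]

end WeakT

end WeakSpecht

theorem mainTheorem1 (D : Type*) [CommRing D] [IsDomain D] [IsNoetherianRing D] :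
    (∀ J : TwoSidedIdeal (FreeAlgebra D WeakSpecht.Var),
      WeakSpecht.IsWeakTIdeal J → WeakSpecht.basicIdeal D ≤ J →
        WeakSpecht.IsFinGen J ∧
        (WeakSpecht.IsHomogeneousIdeal J → WeakSpecht.IsHomogeneouslyFinGen J)) ∧
    WeakSpecht.HasSpechtProperty (WeakSpecht.slIdentities D) := by
  have main : ∀ J : TwoSidedIdeal (FreeAlgebra D WeakSpecht.Var),
      WeakSpecht.IsWeakTIdeal J → WeakSpecht.basicIdeal D ≤ J → WeakSpecht.IsFinGen J :=
    fun J hJ hle => WeakSpecht.isFinGen_of_basicIdeal_le hJ hle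
  exact ⟨fun J hJ hle => ⟨main J hJ hle, fun hom =>
      WeakSpecht.IsFinGen.isHomogeneouslyFinGen hJ hom (main J hJ hle)⟩,
    WeakSpecht.isWeakTIdeal_slIdentities,
    main _ WeakSpecht.isWeakTIdeal_slIdentities WeakSpecht.basicIdeal_le_slIdentities,
    fun K hK hle => main K hK (WeakSpecht.basicIdeal_le_slIdentities.trans hle)⟩
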